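/- **Setting.** Fix an integer $d\ge 2$. For finite $\Lambda\subset\mathbb Z^2$ let $\mathcal A_\Lambda=\bigotimes_{z\in\Lambda}M_d(\mathbb C)$; for infinite $\Gamma\subset\mathbb Z^2$ let $\mathcal A_\Gamma$ be the C*-inductive limit of the $\mathcal A_\Lambda$, $\Lambda\subset\Gamma$ finite, regarded as a subalgebra of $\mathcal A:=\mathcal A_{\mathbb Z^2}$. For $\Gamma\subset\mathbb R^2$ write $\mathcal A_\Gamma:=\mathcal A_{\Gamma\cap\mathbb Z^2}$, and let $\Gamma^c$ be the complement in $\mathbb R^2$. Automorphisms are $*$-automorphisms, and $\mathrm{Ad}(u)(x)=uxu^*$. For $a\in\mathbb R^2$, $\theta\in\mathbb R$, $\phi\in(0,\pi)$ and $e_\theta=(\cos\theta,\sin\theta)$, the cone $\Lambda=\Lambda_{a,\theta,\phi}$ is $\{x\in\mathbb R^2: (x-a)\cdot e_\theta>\cos\phi\,\|x-a\|\}$. Put $|\arg\Lambda|=2\phi$, $e_\Lambda=e_\theta$, and $\Lambda_{\varepsilon}=\Lambda_{a,\theta,\phi+\varepsilon}$ for real $\varepsilon$ with $0<\phi+\varepsilon<\pi$.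 For $0<\delta<\phi$, $(\Lambda^c)_\delta$ denotes $(\Lambda_{-\delta})^c$. Statements about fattened regions below are required only for those $\delta,\delta'>0$ for which the fattened regions are defined. **Approximate Haag duality.** An irreducible representation $(\mathcal H,\pi)$ of $\mathcal A$ satisfies approximate Haag duality if for all $\varphi\in(0,2\pi)$ and $\varepsilon>0$ with $\varphi+4\varepsilon<2\pi$ there are $R>0$ and, for each $\delta>0$, a decreasing function $f_\delta$ on $[0,\infty)$ with $\lim_{t\to\infty}f_\delta(t)=0$ such that for every cone $\Lambda$ with $|\arg\Lambda|=\varphi$ there is a unitary $U$ on $\mathcal H$ satisfying: 1. $\pi(\mathcal A_{\Lambda^c})'\subset \mathrm{Ad}(U)\big(\pi(\mathcal A_{(\Lambda-Re_\Lambda)_\varepsilon})''\big)$; 2. for all $\delta>0$ and $t\ge0$ there is a unitary $\tilde U\in\pi(\mathcal A_{\Lambda_{\varepsilon+\delta}-te_\Lambda})''$ with $\|U-\tilde U\|\le f_\delta(t)$. **Approximately factorizable automorphisms.** An automorphism $\alpha$ of $\mathcal A$ is approximately factorizable if for all $\varphi\in(0,2\pi)$ and $\delta>0$ there are, for each $\delta'>0$,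 a decreasing function $g_{\delta'}$ on $[0,\infty)$ with limit $0$ at infinity, such that for every cone $\Lambda$ with $|\arg\Lambda|=\varphi$ there are unitaries $v,\tilde v\in\mathcal A$ satisfying: 1. $\alpha=\mathrm{Ad}(v)\circ\Xi\circ(\beta_\Lambda\otimes\beta_{\Lambda^c})$ and $\alpha^{-1}=\mathrm{Ad}(\tilde v)\circ\tilde\Xi\circ(\tilde\beta_\Lambda\otimes\tilde\beta_{\Lambda^c})$ for some $\beta_\Lambda,\tilde\beta_\Lambda\in\mathrm{Aut}(\mathcal A_\Lambda)$, $\beta_{\Lambda^c},\tilde\beta_{\Lambda^c}\in\mathrm{Aut}(\mathcal A_{\Lambda^c})$ and $\Xi,\tilde\Xi\in\mathrm{Aut}(\mathcal A_{\Lambda_\delta\cap(\Lambda^c)_\delta})$ (the latter two extended to $\mathcal A$ by the identity on $\mathcal A_{(\Lambda_\delta\cap(\Lambda^c)_\delta)^c}$); 2. for all $\delta'>0$ and $t\ge0$ there are unitaries $v',\tilde v'\in\mathcal A_{\Lambda_{\delta+\delta'}-te_\Lambda}$ with $\|v-v'\|\le g_{\delta'}(t)$ and $\|\tilde v-\tilde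 v'\|\le g_{\delta'}(t)$. **Proposition.** Let $(\mathcal H,\pi_0)$ be an irreducible representation of $\mathcal A$ satisfying approximate Haag duality. Then for every approximately factorizable automorphism $\alpha$ of $\mathcal A$, the representation $(\mathcal H,\pi_0\circ\alpha)$ is irreducible and satisfies approximate Haag duality. -/

import Mathlib

open Set Filter Topology

noncomputable section

/-! ### The quantum spin algebra on the square lattice

The quasi-local algebra is realised concretely, as an algebra of bounded operators.  Let `Ω` be the
set of all spin configurations `ℤ × ℤ → Fin d`.  A matrix `M` at the site `z` acts on `ℓ²(Ω)` by
`(M ψ)(σ) = ∑ j, M (σ z) j * ψ (σ with the value j at z)`.  This gives mutually commuting faithful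
unital copies of `M_d(ℂ)`, one for each site, so that the star algebra generated by the sites of a
finite set is the tensor product of the copies, and the norm closure of the star algebra generated by
the sites of an infinite set is the C*-inductive limit of these tensor products (the C*-norm on the
union of the finite tensor products is unique). -/

namespace SpinSystem

/-- Spin configurations on the square lattice. -/
abbrev Config (d : ℕ) : Type := ℤ × ℤ → Fin d

/-- The Hilbert space `ℓ²` over all spin configurations. -/
abbrev ConfigSpace (d : ℕ) : Type := lp (fun _ : Config d => ℂ) 2

/-- Bounded operators on `ConfigSpace d`. -/
abbrev ConfigOp (d : ℕ) : Type := ConfigSpace d →L[ℂ] ConfigSpace d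

theorem sum_siteUnit_le {d : ℕ} (z : ℤ × ℤ) (i j : Fin d) (ψ : ConfigSpace d)
    (s : Finset (Config d)) :
    ∑ σ ∈ s, ‖(if σ z = i then ψ (Function.update σ z j) else 0 : ℂ)‖ ^ (2 : ENNReal).toReal
      ≤ ‖ψ‖ ^ (2 : ENNReal).toReal := by
  classical
  have h1 : ∑ σ ∈ s, ‖(if σ z = i then ψ (Function.update σ z j) else 0 : ℂ)‖
        ^ (2 : ENNReal).toReal
      = ∑ σ ∈ s.filter (fun σ => σ z = i),
        ‖ψ (Function.update σ z j)‖ ^ (2 : ENNReal).toReal := by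
    rw [Finset.sum_filter]
    refine Finset.sum_congr rfl fun σ _ => ?_
    split_ifs <;> simp
  have hinj : Set.InjOn (fun σ : Config d => Function.update σ z j)
      (s.filter (fun σ => σ z = i) : Finset (Config d)) := by
    intro σ hσ τ hτ h
    simp only [Finset.coe_filter, Set.mem_ofPred_eq] at hσ hτ
    funext w
    by_cases hw : w = z
    · rw [hw, hσ.2, hτ.2]
    · have := congrFun h w
      simpa [Function.update_of_ne hw] using this
  rw [h1, ← Finset.sum_image (f := fun σ => ‖ψ σ‖ ^ (2 : ENNReal).toReal) hinj]
  exact lp.sum_rpow_le_norm_rpow (by norm_num) ψ _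

/-- The matrix unit `e_{ij}` at the site `z`. -/
def siteUnit {d : ℕ} (z : ℤ × ℤ) (i j : Fin d) : ConfigOp d :=
  LinearMap.mkContinuous
    { toFun := fun ψ =>
        ⟨fun σ => if σ z = i then ψ (Function.update σ z j) else 0,
          memℓp_gen' (sum_siteUnit_le z i j ψ)⟩
      map_add' := fun ψ χ => by
        ext σ
        change (if σ z = i then (ψ + χ) (Function.update σ z j) else 0 : ℂ)
          = (if σ z = i then ψ (Function.update σ z j) else 0)
            + (if σ z = i then χ (Function.update σ z j) else 0)
        by_cases h : σ z = i <;> simp [h]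
      map_smul' := fun c ψ => by
        ext σ
        by_cases h : σ z = i <;> simp [h] }
    1 (fun ψ => by
      rw [one_mul]
      exact lp.norm_le_of_forall_sum_le (by norm_num) (norm_nonneg _) (sum_siteUnit_le z i j ψ))

theorem siteUnit_apply {d : ℕ} (z : ℤ × ℤ) (i j : Fin d) (ψ : ConfigSpace d) (σ : Config d) :
    siteUnit z i j ψ σ = if σ z = i then ψ (Function.update σ z j) else 0 := rfl

/-- The operator on `ℓ²(Ω)` given by a matrix at the site `z`. -/
def siteOp {d : ℕ} (z : ℤ × ℤ) (M : Matrix (Fin d) (Fin d) ℂ) : ConfigOp d :=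
  ∑ i, ∑ j, M i j • siteUnit z i j

theorem siteOp_apply {d : ℕ} (z : ℤ × ℤ) (M : Matrix (Fin d) (Fin d) ℂ) (ψ : ConfigSpace d)
    (σ : Config d) :
    siteOp z M ψ σ = ∑ j, M (σ z) j * ψ (Function.update σ z j) := by
  simp only [siteOp, sum_apply, smul_apply,
    lp.coeFn_sum, Finset.sum_apply, lp.coeFn_smul, Pi.smul_apply, siteUnit_apply, smul_eq_mul,
    mul_ite, mul_zero]
  rw [Finset.sum_comm]
  refine Finset.sum_congr rfl fun j _ => ?_
  simp

theorem star_siteUnit {d : ℕ} (z : ℤ × ℤ) (i j : Fin d) :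
    star (siteUnit z i j) = siteUnit z j i := by
  rw [ContinuousLinearMap.star_eq_adjoint]
  symm
  rw [ContinuousLinearMap.eq_adjoint_iff]
  intro ψ χ
  have hinv : Function.Involutive
      (fun σ : Config d => Function.update σ z (Equiv.swap i j (σ z))) := by
    intro σ
    simp only [Function.update_self, Equiv.swap_apply_self, Function.update_idem,
      Function.update_eq_self]
  rw [lp.inner_eq_tsum, lp.inner_eq_tsum,
    ← (hinv.toPerm _).tsum_eq (fun σ => inner ℂ (ψ σ) (siteUnit z i j χ σ))]
  refine tsum_congr fun σ => ?_
  simp only [Function.Involutive.coe_toPerm, siteUnit_apply, Function.update_self,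
    Function.update_idem]
  by_cases h : σ z = j
  · subst h
    simp
  · have h' : Equiv.swap i j (σ z) ≠ i := by
      intro h2
      apply h
      have := congrArg (Equiv.swap i j) h2
      simpa using this
    simp [h, h']

/-- The embedding of `M_d(ℂ)` as the algebra of the single site `z`. -/
def siteHom {d : ℕ} (z : ℤ × ℤ) : Matrix (Fin d) (Fin d) ℂ →⋆ₐ[ℂ] ConfigOp d where
  toFun := siteOp z
  map_one' := by
    ext ψ σ
    simp [siteOp_apply, Matrix.one_apply]
  map_mul' M N := by
    ext ψ σ
    simp only [mul_apply_eq_comp, siteOp_apply, Matrix.mul_apply,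
      Function.update_self, Function.update_idem, Finset.sum_mul, Finset.mul_sum]
    rw [Finset.sum_comm]
    refine Finset.sum_congr rfl fun j _ => Finset.sum_congr rfl fun k _ => ?_
    ring
  map_zero' := by
    ext ψ σ
    simp [siteOp_apply]
  map_add' M N := by
    ext ψ σ
    simp [siteOp_apply, add_mul, Finset.sum_add_distrib]
  commutes' c := by
    ext ψ σ
    simp [siteOp_apply, Matrix.algebraMap_matrix_apply, ContinuousLinearMap.algebraMap_apply]
  map_star' M := by
    simp only [siteOp, star_sum, star_smul, star_siteUnit, Matrix.star_apply]
    rw [Finset.sum_comm]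

/-- The quantum spin algebra `𝒜` of the whole lattice: the C*-algebra generated by the matrix
algebras of all sites. -/
def spinAlgebra (d : ℕ) : StarSubalgebra ℂ (ConfigOp d) :=
  (StarAlgebra.adjoin ℂ
    {a : ConfigOp d | ∃ (z : ℤ × ℤ) (M : Matrix (Fin d) (Fin d) ℂ), a = siteHom z M}).topologicalClosure

theorem siteHom_mem {d : ℕ} (z : ℤ × ℤ) (M : Matrix (Fin d) (Fin d) ℂ) :
    siteHom z M ∈ spinAlgebra d :=
  StarSubalgebra.le_topologicalClosure _ (StarAlgebra.subset_adjoin ℂ _ ⟨z, M, rfl⟩)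

/-- The observable in `𝒜` given by a matrix at the site `z`. -/
def site {d : ℕ} (z : ℤ × ℤ) (M : Matrix (Fin d) (Fin d) ℂ) : spinAlgebra d :=
  ⟨siteHom z M, siteHom_mem z M⟩

/-! ### Regions and cones -/

/-- The Euclidean plane. -/
abbrev Plane : Type := EuclideanSpace ℝ (Fin 2)

/-- The lattice point `z`, as a point of the plane. -/
def latticePoint (z : ℤ × ℤ) : Plane := !₂[(z.1 : ℝ), (z.2 : ℝ)]

/-- The algebra `𝒜_Γ` of a region `Γ` of the plane: the C*-subalgebra of `𝒜` generated by the
matrix algebras of the sites in `Γ`. -/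
def regionAlgebra (d : ℕ) (Γ : Set Plane) : StarSubalgebra ℂ (spinAlgebra d) :=
  (StarAlgebra.adjoin ℂ
    {a : spinAlgebra d | ∃ z : ℤ × ℤ, latticePoint z ∈ Γ ∧
      ∃ M : Matrix (Fin d) (Fin d) ℂ, a = site z M}).topologicalClosure

/-- The unit vector `e_θ = (cos θ, sin θ)`. -/
def unitVec (θ : ℝ) : Plane := !₂[Real.cos θ, Real.sin θ]

/-- The data `(a, θ, φ)` of a cone `Λ_{a,θ,φ}`: its apex, the direction of its axis and half of its
opening angle.  A cone has `halfAngle ∈ (0, π)`, see `Cone.IsCone`. -/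
structure Cone where
  apex : Plane
  dir : ℝ
  halfAngle : ℝ

namespace Cone

/-- The condition `φ ∈ (0, π)` under which the data define a cone. -/
def IsCone (Λ : Cone) : Prop := 0 < Λ.halfAngle ∧ Λ.halfAngle < Real.pi

/-- The vector `e_Λ`. -/
def axis (Λ : Cone) : Plane := unitVec Λ.dir

/-- The opening angle `|arg Λ|`. -/
def angle (Λ : Cone) : ℝ := 2 * Λ.halfAngle

/-- The set of points of a cone (meaningful under `IsCone`). -/
def toSet (Λ : Cone) : Set Plane :=
  {x | Real.cos Λ.halfAngle * ‖x - Λ.apex‖ < inner ℝ (x - Λ.apex) Λ.axis}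

/-- The cone `Λ_ε`, with the same apex and axis and with the angle widened by `ε` on each side
(narrowed, if `ε < 0`).  It is a cone as long as `0 < φ + ε < π`. -/
def fatten (Λ : Cone) (ε : ℝ) : Cone := ⟨Λ.apex, Λ.dir, Λ.halfAngle + ε⟩

/-- The translated cone `Λ - t e_Λ`. -/
def pullBack (Λ : Cone) (t : ℝ) : Cone := ⟨Λ.apex - t • Λ.axis, Λ.dir, Λ.halfAngle⟩

/-- The region `Λ_δ ∩ (Λᶜ)_δ` around the boundary of `Λ`.  The fattened complement `(Λᶜ)_δ` is the
complement of the narrowed cone `Λ_{-δ}`. -/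
def boundaryStrip (Λ : Cone) (δ : ℝ) : Set Plane :=
  (Λ.fatten δ).toSet ∩ (Λ.fatten (-δ)).toSetᶜ

end Cone

/-! ### Representations and approximate Haag duality -/

section Representation

variable {d : ℕ} {H : Type*} [NormedAddCommGroup H] [InnerProductSpace ℂ H] [CompleteSpace H]

/-- A representation is irreducible if the space is nonzero and the only closed invariant subspaces
are the trivial ones. -/
def IsIrreducibleRep (π : spinAlgebra d →⋆ₐ[ℂ] (H →L[ℂ] H)) : Prop :=
  Nontrivial H ∧
    ∀ K : Submodule ℂ H, IsClosed (K : Set H) →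
      (∀ a : spinAlgebra d, ∀ x ∈ K, π a x ∈ K) → K = ⊥ ∨ K = ⊤

/-- The commutant `π(𝒜_Γ)'`. -/
def regionCommutant (π : spinAlgebra d →⋆ₐ[ℂ] (H →L[ℂ] H)) (Γ : Set Plane) : Set (H →L[ℂ] H) :=
  Set.centralizer (π '' (regionAlgebra d Γ : Set (spinAlgebra d)))

/-- The von Neumann algebra `π(𝒜_Γ)''`. -/
def regionBicommutant (π : spinAlgebra d →⋆ₐ[ℂ] (H →L[ℂ] H)) (Γ : Set Plane) :
    Set (H →L[ℂ] H) :=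
  Set.centralizer (regionCommutant π Γ)

/-- A decreasing function on `[0, ∞)` with limit `0` at infinity. -/
def IsDecay (f : ℝ → ℝ) : Prop := AntitoneOn f (Set.Ici 0) ∧ Tendsto f atTop (𝓝 0)

/-- Approximate Haag duality, a property of irreducible representations.  In the second condition `δ` ranges
over all positive numbers for which the fattened cone `Λ_{ε+δ}` exists. -/
def ApproxHaagDuality (π : spinAlgebra d →⋆ₐ[ℂ] (H →L[ℂ] H)) : Prop :=
  ∀ φ ε : ℝ, 0 < φ → φ < 2 * Real.pi → 0 < ε → φ + 4 * ε < 2 * Real.pi →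
    ∃ (R : ℝ) (f : ℝ → ℝ → ℝ), 0 < R ∧ (∀ δ, 0 < δ → IsDecay (f δ)) ∧
      ∀ Λ : Cone, Λ.IsCone → Λ.angle = φ →
        ∃ U : unitary (H →L[ℂ] H),
          regionCommutant π Λ.toSetᶜ ⊆
            (Unitary.conjStarAlgAut ℂ (H →L[ℂ] H) U) ''
              regionBicommutant π ((Λ.pullBack R).fatten ε).toSet ∧
          ∀ δ t : ℝ, 0 < δ → (Λ.fatten (ε + δ)).IsCone → 0 ≤ t →
            ∃ V : unitary (H →L[ℂ] H),
              (V : H →L[ℂ] H) ∈ regionBicommutant π ((Λ.fatten (ε + δ)).pullBack t).toSet ∧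
              ‖(U : H →L[ℂ] H) - (V : H →L[ℂ] H)‖ ≤ f δ t

end Representation

/-! ### Approximately factorizable automorphisms -/

/-- `γ = β ⊗ β'` for the decomposition `𝒜 = 𝒜_Γ ⊗ 𝒜_{Γᶜ}`: the automorphism `γ` of `𝒜` is `β` on
`𝒜_Γ` and `β'` on `𝒜_{Γᶜ}`.  (There is exactly one such `γ` for given `β` and `β'`.) -/
def IsTensorAut {d : ℕ} {Γ : Set Plane}
    (β : regionAlgebra d Γ ≃⋆ₐ[ℂ] regionAlgebra d Γ)
    (β' : regionAlgebra d Γᶜ ≃⋆ₐ[ℂ] regionAlgebra d Γᶜ)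
    (γ : spinAlgebra d ≃⋆ₐ[ℂ] spinAlgebra d) : Prop :=
  (∀ a : regionAlgebra d Γ, γ (a : spinAlgebra d) = (β a : spinAlgebra d)) ∧
  (∀ a : regionAlgebra d Γᶜ, γ (a : spinAlgebra d) = (β' a : spinAlgebra d))

/-- `α = Ad(v) ∘ Ξ ∘ (β_Λ ⊗ β_{Λᶜ})` with automorphisms `β_Λ` of `𝒜_Λ`, `β_{Λᶜ}` of `𝒜_{Λᶜ}` and
`Ξ` of the algebra of the boundary strip `Λ_δ ∩ (Λᶜ)_δ`; `Ξ` acts on `𝒜` as `Ξ ⊗ id`. -/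
def FactorizesAlong {d : ℕ} (α : spinAlgebra d ≃⋆ₐ[ℂ] spinAlgebra d) (Λ : Cone) (δ : ℝ)
    (v : unitary (spinAlgebra d)) : Prop :=
  ∃ (β : regionAlgebra d Λ.toSet ≃⋆ₐ[ℂ] regionAlgebra d Λ.toSet)
    (β' : regionAlgebra d Λ.toSetᶜ ≃⋆ₐ[ℂ] regionAlgebra d Λ.toSetᶜ)
    (Ξ : regionAlgebra d (Λ.boundaryStrip δ) ≃⋆ₐ[ℂ] regionAlgebra d (Λ.boundaryStrip δ))
    (γ ξ : spinAlgebra d ≃⋆ₐ[ℂ] spinAlgebra d),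
    IsTensorAut β β' γ ∧ IsTensorAut Ξ (StarAlgEquiv.refl ℂ _) ξ ∧
      ∀ a : spinAlgebra d, α a = Unitary.conjStarAlgAut ℂ (spinAlgebra d) v (ξ (γ a))

/-- Approximately factorizable automorphisms.  The unitary `v` (for `α`) and `w` (for `α⁻¹`) depend
on `Λ` and `δ`, the decay function `g δ'` only on the opening angle `φ`, on `δ` and on `δ'`.
The numbers `δ` and `δ'` range over all positive numbers for which the fattened cones `Λ_δ`,
`(Λᶜ)_δ` and `Λ_{δ+δ'}` exist. -/
def ApproxFactorizable {d : ℕ} (α : spinAlgebra d ≃⋆ₐ[ℂ] spinAlgebra d) : Prop :=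
  ∀ φ δ : ℝ, 0 < φ → φ < 2 * Real.pi → 0 < δ →
    ∃ g : ℝ → ℝ → ℝ, (∀ δ', 0 < δ' → IsDecay (g δ')) ∧
      ∀ Λ : Cone, Λ.IsCone → Λ.angle = φ → (Λ.fatten δ).IsCone → (Λ.fatten (-δ)).IsCone →
        ∃ v w : unitary (spinAlgebra d),
          FactorizesAlong α Λ δ v ∧ FactorizesAlong α.symm Λ δ w ∧
          ∀ δ' t : ℝ, 0 < δ' → (Λ.fatten (δ + δ')).IsCone → 0 ≤ t →
            ∃ v' w' : unitary (spinAlgebra d),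
              (v' : spinAlgebra d) ∈
                regionAlgebra d ((Λ.fatten (δ + δ')).pullBack t).toSet ∧
              (w' : spinAlgebra d) ∈
                regionAlgebra d ((Λ.fatten (δ + δ')).pullBack t).toSet ∧
              ‖(v : spinAlgebra d) - (v' : spinAlgebra d)‖ ≤ g δ' t ∧
              ‖(w : spinAlgebra d) - (w' : spinAlgebra d)‖ ≤ g δ' t

end SpinSystem

end

namespace SpinSystem

/-! ### Commutants and conjugation -/

section Commutant

variable {B : Type*} [Ring B] [StarRing B] [Algebra ℂ B]

/-! Irreducibility survives because `π` and `π ∘ α` have the same range.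

For duality, let `X` commute with `πα(𝒜_{Λᶜ})`. Factor `α` along `Λ` with a small angle `κ`. Outside
`Λ_κ` the strip automorphism is trivial, so every element of `Ad(v)(𝒜_{(Λ_κ)ᶜ})` is `α` of something
in `𝒜_{Λᶜ}`, and `Ad(π(v))⁻¹ X` commutes with `π(𝒜_{(Λ_κ)ᶜ})`
(`FactorizesAlong.conj_mem_regionCommutant`). Duality for `π` at `Λ_κ` gives a unitary `U₀` and puts
this operator in `Ad(U₀) π(𝒜_Γ)''`, where `Γ = Λ_{2κ} - R e_Λ`. Factoring `α⁻¹` along `Γ` turns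
`π(𝒜_Γ)''` into a subset of `Ad(πα(w)) πα(𝒜_{Γ_κ})''`
(`FactorizesAlong.conj_mem_regionBicommutant`). Hence `U = π(v) U₀ πα(w)` works.

For the tails of `U`, the factor `πα(w)` is already approximated inside algebras of `πα`, but `π(v)
U₀` is approximated only inside some `π(𝒜_D)''`. One more factorization of `α⁻¹`, along `D`, carries
that approximant into a bicommutant of `πα` with a small error
(`exists_unitary_regionBicommutant_comp`). -/

theorem symm_mul_comm_iff (c : B ≃⋆ₐ[ℂ] B) (x y : B) :
    c.symm x * y = y * c.symm x ↔ x * c y = c y * x := by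
  rw [← (EquivLike.injective c).eq_iff, map_mul, map_mul, StarAlgEquiv.apply_symm_apply]

/-- Transport of commutants along an automorphism that maps `S` into `T`. -/
theorem symm_mem_centralizer (c : B ≃⋆ₐ[ℂ] B) {S T : Set B} (h : ∀ s ∈ S, c s ∈ T) {x : B}
    (hx : x ∈ T.centralizer) : c.symm x ∈ S.centralizer := by
  intro s hs
  exact ((symm_mul_comm_iff c x s).2 (hx _ (h s hs)).symm).symm

/-- The hypothesis makes `c` map the commutant of `T` into that of `S`; then `symm_mem_centralizer`
applies one level up. -/
theorem symm_mem_centralizer_centralizer (c : B ≃⋆ₐ[ℂ] B) {S T : Set B}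
    (h : ∀ s ∈ S, c.symm s ∈ T) {x : B} (hx : x ∈ S.centralizer.centralizer) :
    c.symm x ∈ T.centralizer.centralizer := by
  refine symm_mem_centralizer c (fun y hy => ?_) hx
  intro s hs
  exact (symm_mul_comm_iff c s y).1 (hy _ (h s hs))

end Commutant

section UnitaryNorm

variable {B : Type*} [NormedRing B] [StarRing B] [CStarRing B]

/-- Telescoping: `ab - a'b' = (a - a')b + a'(b - b')`, and unitary factors do not change norms. -/
theorem norm_unitary_mul_sub_le (a a' b b' : unitary B) :
    ‖((a * b : unitary B) : B) - ((a' * b' : unitary B) : B)‖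
      ≤ ‖(a : B) - a'‖ + ‖(b : B) - b'‖ := by
  have h : ((a * b : unitary B) : B) - ((a' * b' : unitary B) : B)
      = ((a : B) - a') * b + a' * ((b : B) - b') := by
    push_cast
    noncomm_ring
  rw [h]
  refine (norm_add_le _ _).trans (le_of_eq ?_)
  rw [CStarRing.norm_mul_coe_unitary, CStarRing.norm_coe_unitary_mul]

theorem norm_unitary_star_sub (a a' : unitary B) :
    ‖((star a : unitary B) : B) - ((star a' : unitary B) : B)‖ = ‖(a : B) - a'‖ := by
  rw [Unitary.coe_star, Unitary.coe_star, ← star_sub, norm_star]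

theorem norm_unitary_sub_one_le (a : unitary B) : ‖(a : B) - 1‖ ≤ 2 := by
  -- `‖1‖ = 1` fails in the zero ring.
  rcases subsingleton_or_nontrivial B with _ | _
  · rw [Subsingleton.elim ((a : B) - 1) 0, norm_zero]
    norm_num
  · refine (norm_sub_le _ _).trans ?_
    rw [CStarRing.norm_coe_unitary, CStarRing.norm_one]
    norm_num

end UnitaryNorm

/-! ### The C*-structure of the spin algebra -/

section Algebra

variable {d : ℕ}

theorem isClosed_spinAlgebra : IsClosed (spinAlgebra d : Set (ConfigOp d)) :=
  StarSubalgebra.isClosed_topologicalClosure _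

noncomputable instance instCStarAlgebraSpinAlgebra : CStarAlgebra (spinAlgebra d) :=
  StarSubalgebra.cstarAlgebra (spinAlgebra d) (h_closed := isClosed_spinAlgebra)

theorem isClosed_regionAlgebra (Γ : Set Plane) :
    IsClosed (regionAlgebra d Γ : Set (spinAlgebra d)) :=
  StarSubalgebra.isClosed_topologicalClosure _

theorem site_mem_regionAlgebra {Γ : Set Plane} {z : ℤ × ℤ} (hz : latticePoint z ∈ Γ)
    (M : Matrix (Fin d) (Fin d) ℂ) : site z M ∈ regionAlgebra d Γ :=
  StarSubalgebra.le_topologicalClosure _ (StarAlgebra.subset_adjoin ℂ _ ⟨z, hz, M, rfl⟩)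

theorem regionAlgebra_le {Γ : Set Plane} {S : StarSubalgebra ℂ (spinAlgebra d)}
    (hS : IsClosed (S : Set (spinAlgebra d)))
    (h : ∀ z, latticePoint z ∈ Γ → ∀ M : Matrix (Fin d) (Fin d) ℂ, site z M ∈ S) :
    regionAlgebra d Γ ≤ S := by
  refine StarSubalgebra.topologicalClosure_minimal (StarAlgebra.adjoin_le ?_) hS
  rintro _ ⟨z, hz, M, rfl⟩
  exact h z hz M

theorem regionAlgebra_mono {Γ Γ' : Set Plane} (h : Γ ⊆ Γ') :
    regionAlgebra d Γ ≤ regionAlgebra d Γ' :=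
  regionAlgebra_le (isClosed_regionAlgebra _) fun _ hz M => site_mem_regionAlgebra (h hz) M

theorem continuous_starAlgEquiv (ξ : spinAlgebra d ≃⋆ₐ[ℂ] spinAlgebra d) : Continuous ξ :=
  AddMonoidHomClass.continuous_of_bound ξ 1 fun a => by
    simpa only [one_mul] using NonUnitalStarAlgHom.norm_apply_le ξ a

/-- Star automorphisms are contractive, so the preimage of a closed star subalgebra is again closed,
and checking single sites suffices. -/
theorem map_mem_regionAlgebra (ξ : spinAlgebra d ≃⋆ₐ[ℂ] spinAlgebra d) {Γ Γ' : Set Plane}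
    (h : ∀ z, latticePoint z ∈ Γ → ∀ M, ξ (site z M) ∈ regionAlgebra d Γ')
    {a : spinAlgebra d} (ha : a ∈ regionAlgebra d Γ) : ξ a ∈ regionAlgebra d Γ' :=
  regionAlgebra_le (S := (regionAlgebra d Γ').comap ξ.toStarAlgHom)
    ((isClosed_regionAlgebra Γ').preimage (continuous_starAlgEquiv ξ)) h ha

end Algebra

/-! ### Geometry of cones -/

theorem norm_unitVec (θ : ℝ) : ‖unitVec θ‖ = 1 := by
  simp [unitVec, EuclideanSpace.norm_eq]

namespace Cone

theorem toSet_fatten_mono (Λ : Cone) {a b : ℝ} (ha : 0 ≤ Λ.halfAngle + a) (hab : a ≤ b)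
    (hb : Λ.halfAngle + b ≤ Real.pi) : (Λ.fatten a).toSet ⊆ (Λ.fatten b).toSet := by
  intro x hx
  refine lt_of_le_of_lt (mul_le_mul_of_nonneg_right ?_ (norm_nonneg _)) hx
  exact Real.cos_le_cos_of_nonneg_of_le_pi ha hb (by simpa [fatten] using hab)

/-- Pulling the apex back by `t - s` raises the axial component by exactly `t - s` and changes the
norm by at most `t - s`; since `|cos| ≤ 1`, the cone inequality persists, also for half-angles above
`π/2`. -/
theorem toSet_pullBack_mono (Λ : Cone) {s t : ℝ} (hst : s ≤ t) :
    (Λ.pullBack s).toSet ⊆ (Λ.pullBack t).toSet := by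
  intro x hx
  have hx' : Real.cos Λ.halfAngle * ‖x - (Λ.apex - s • Λ.axis)‖
      < inner ℝ (x - (Λ.apex - s • Λ.axis)) Λ.axis := hx
  change Real.cos Λ.halfAngle * ‖x - (Λ.apex - t • Λ.axis)‖
      < inner ℝ (x - (Λ.apex - t • Λ.axis)) Λ.axis
  set y := x - (Λ.apex - s • Λ.axis) with hy
  have hn : ‖Λ.axis‖ = 1 := norm_unitVec _
  have e : x - (Λ.apex - t • Λ.axis) = y + (t - s) • Λ.axis := by
    rw [hy]; module
  have hs : ‖(t - s) • Λ.axis‖ = t - s := by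
    rw [norm_smul, hn, Real.norm_of_nonneg (by linarith), mul_one]
  have h1 : |‖y + (t - s) • Λ.axis‖ - ‖y‖| ≤ t - s := by
    have := abs_norm_sub_norm_le (y + (t - s) • Λ.axis) y
    rwa [add_sub_cancel_left, hs] at this
  have h2 : Real.cos Λ.halfAngle * (‖y + (t - s) • Λ.axis‖ - ‖y‖) ≤ t - s := by
    refine (le_abs_self _).trans ?_
    rw [abs_mul]
    calc _ ≤ 1 * |‖y + (t - s) • Λ.axis‖ - ‖y‖| :=
          mul_le_mul_of_nonneg_right (Real.abs_cos_le_one _) (abs_nonneg _)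
      _ ≤ t - s := by rwa [one_mul]
  rw [e, inner_add_left, real_inner_smul_left, real_inner_self_eq_norm_sq, hn]
  linarith

theorem fatten_fatten (Λ : Cone) (a b : ℝ) : (Λ.fatten a).fatten b = Λ.fatten (a + b) := by
  simp [fatten, add_assoc]

theorem fatten_pullBack (Λ : Cone) (a t : ℝ) :
    (Λ.fatten a).pullBack t = (Λ.pullBack t).fatten a := rfl

theorem pullBack_pullBack (Λ : Cone) (s t : ℝ) :
    (Λ.pullBack s).pullBack t = Λ.pullBack (s + t) := by
  simp [pullBack, axis, add_smul, sub_sub]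

theorem fatten_zero (Λ : Cone) : Λ.fatten 0 = Λ := by
  simp [fatten]

theorem toSet_fatten_pullBack_mono (Λ : Cone) {a b s t : ℝ} (ha : 0 ≤ Λ.halfAngle + a)
    (hab : a ≤ b) (hb : Λ.halfAngle + b ≤ Real.pi) (hst : s ≤ t) :
    ((Λ.fatten a).pullBack s).toSet ⊆ ((Λ.fatten b).pullBack t).toSet :=
  (toSet_fatten_mono (Λ.pullBack s) ha hab hb).trans (toSet_pullBack_mono (Λ.fatten b) hst)

end Cone

/-! ### Consequences of a factorization -/

section Factorization

variable {d : ℕ} {α : spinAlgebra d ≃⋆ₐ[ℂ] spinAlgebra d} {Λ : Cone} {δ : ℝ}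
  {v : unitary (spinAlgebra d)}

/-- A site of `Λ` is either in the strip, where `Ξ` keeps it inside the strip and so inside `Λ_δ`,
or off the strip, where it is fixed. -/
theorem FactorizesAlong.conj_mem (h : FactorizesAlong α Λ δ v)
    (hsub : Λ.toSet ⊆ (Λ.fatten δ).toSet) {a : spinAlgebra d}
    (ha : a ∈ regionAlgebra d Λ.toSet) :
    (star v : unitary (spinAlgebra d)) * α a * v ∈ regionAlgebra d (Λ.fatten δ).toSet := by
  obtain ⟨β, β', Ξ, γ, ξ, hγ, hξ, hα⟩ := h
  have h1 : γ a ∈ regionAlgebra d Λ.toSet := by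
    rw [hγ.1 ⟨a, ha⟩]
    exact (β ⟨a, ha⟩).2
  have h2 : ξ (γ a) ∈ regionAlgebra d (Λ.fatten δ).toSet := by
    refine map_mem_regionAlgebra ξ (fun z hz M => ?_) h1
    by_cases hs : latticePoint z ∈ Λ.boundaryStrip δ
    · rw [hξ.1 ⟨site z M, site_mem_regionAlgebra hs M⟩]
      exact regionAlgebra_mono inter_subset_left
        (Ξ ⟨site z M, site_mem_regionAlgebra hs M⟩).2
    · rw [hξ.2 ⟨site z M, site_mem_regionAlgebra hs M⟩]
      exact site_mem_regionAlgebra (hsub hz) M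
  rw [hα, Unitary.coe_star, ← Unitary.conjStarAlgAut_symm_apply (S := ℂ),
    StarAlgEquiv.symm_apply_apply]
  exact h2

/-- The strip lies in `Λ_δ`, so `Ξ` fixes `y`, and the preimage of `y` under `β_{Λᶜ}` is the
required element. -/
theorem FactorizesAlong.exists_apply_eq_conj (h : FactorizesAlong α Λ δ v)
    (hsub : Λ.toSet ⊆ (Λ.fatten δ).toSet) {y : spinAlgebra d}
    (hy : y ∈ regionAlgebra d (Λ.fatten δ).toSetᶜ) :
    ∃ x ∈ regionAlgebra d Λ.toSetᶜ,
      α x = Unitary.conjStarAlgAut ℂ (spinAlgebra d) v y := by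
  obtain ⟨β, β', Ξ, γ, ξ, hγ, hξ, hα⟩ := h
  have h1 : y ∈ regionAlgebra d (Λ.boundaryStrip δ)ᶜ :=
    regionAlgebra_mono (compl_subset_compl.2 inter_subset_left) hy
  have h2 : y ∈ regionAlgebra d Λ.toSetᶜ := regionAlgebra_mono (compl_subset_compl.2 hsub) hy
  refine ⟨β'.symm ⟨y, h2⟩, (β'.symm ⟨y, h2⟩).2, ?_⟩
  rw [hα, hγ.2, StarAlgEquiv.apply_symm_apply, hξ.2 ⟨y, h1⟩]
  rfl

end Factorization

/-! ### Representations -/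

section Representation

variable {d : ℕ} {H : Type*} [NormedAddCommGroup H] [InnerProductSpace ℂ H] [CompleteSpace H]

theorem IsIrreducibleRep.comp {π : spinAlgebra d →⋆ₐ[ℂ] (H →L[ℂ] H)} (h : IsIrreducibleRep π)
    (α : spinAlgebra d ≃⋆ₐ[ℂ] spinAlgebra d) : IsIrreducibleRep (π.comp α.toStarAlgHom) := by
  refine ⟨h.1, fun K hK hinv => h.2 K hK fun a x hx => ?_⟩
  have := hinv (α.symm a) x hx
  have e : (π.comp α.toStarAlgHom) (α.symm a) = π a := congrArg π (α.apply_symm_apply a)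
  rwa [e] at this

/-- The image of a unitary under a representation. -/
noncomputable def mapUnitary (π : spinAlgebra d →⋆ₐ[ℂ] (H →L[ℂ] H)) (u : unitary (spinAlgebra d)) :
    unitary (H →L[ℂ] H) :=
  ⟨π u, Unitary.map_mem π u.2⟩

theorem norm_mapUnitary_sub_le (π : spinAlgebra d →⋆ₐ[ℂ] (H →L[ℂ] H))
    (u u' : unitary (spinAlgebra d)) :
    ‖(mapUnitary π u : H →L[ℂ] H) - mapUnitary π u'‖ ≤ ‖(u : spinAlgebra d) - u'‖ := by
  have : (mapUnitary π u : H →L[ℂ] H) - mapUnitary π u' = π ((u : spinAlgebra d) - u') :=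
    (map_sub π _ _).symm
  rw [this]
  exact NonUnitalStarAlgHom.norm_apply_le π _

variable (π : spinAlgebra d →⋆ₐ[ℂ] (H →L[ℂ] H))

theorem regionBicommutant_mono {Γ Γ' : Set Plane} (h : Γ ⊆ Γ') :
    regionBicommutant π Γ ⊆ regionBicommutant π Γ' :=
  Set.centralizer_subset (Set.centralizer_subset (Set.image_mono (regionAlgebra_mono h)))

theorem apply_mem_regionBicommutant {Γ : Set Plane} {a : spinAlgebra d}
    (ha : a ∈ regionAlgebra d Γ) : π a ∈ regionBicommutant π Γ :=
  Set.subset_centralizer_centralizer ⟨a, ha, rfl⟩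

theorem star_apply_mem_regionBicommutant {Γ : Set Plane} {a : spinAlgebra d}
    (ha : a ∈ regionAlgebra d Γ) : star (π a) ∈ regionBicommutant π Γ := by
  rw [← map_star]
  exact apply_mem_regionBicommutant π (star_mem ha)

variable {π} {α : spinAlgebra d ≃⋆ₐ[ℂ] spinAlgebra d} {Λ : Cone} {δ : ℝ}

/-- Since `π(a) = πα(α⁻¹ a)`, the localization of `w* α⁻¹(a) w` in `Λ_δ` passes to bicommutants. -/
theorem FactorizesAlong.conj_mem_regionBicommutant {w : unitary (spinAlgebra d)}
    (h : FactorizesAlong α.symm Λ δ w) (hsub : Λ.toSet ⊆ (Λ.fatten δ).toSet) {X : H →L[ℂ] H}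
    (hX : X ∈ regionBicommutant π Λ.toSet) :
    (Unitary.conjStarAlgAut ℂ (H →L[ℂ] H) (mapUnitary (π.comp α.toStarAlgHom) w)).symm X ∈
      regionBicommutant (π.comp α.toStarAlgHom) (Λ.fatten δ).toSet := by
  refine symm_mem_centralizer_centralizer _ ?_ hX
  rintro _ ⟨a, ha, rfl⟩
  refine ⟨_, h.conj_mem hsub ha, ?_⟩
  rw [Unitary.conjStarAlgAut_symm_apply, map_mul, map_mul]
  have e : (π.comp α.toStarAlgHom) (α.symm a) = π a := congrArg π (α.apply_symm_apply a)
  rw [e, Unitary.coe_star, map_star]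
  rfl

theorem FactorizesAlong.conj_mem_regionCommutant {v : unitary (spinAlgebra d)}
    (h : FactorizesAlong α Λ δ v) (hsub : Λ.toSet ⊆ (Λ.fatten δ).toSet) {X : H →L[ℂ] H}
    (hX : X ∈ regionCommutant (π.comp α.toStarAlgHom) Λ.toSetᶜ) :
    (Unitary.conjStarAlgAut ℂ (H →L[ℂ] H) (mapUnitary π v)).symm X ∈
      regionCommutant π (Λ.fatten δ).toSetᶜ := by
  refine symm_mem_centralizer _ ?_ hX
  rintro _ ⟨y, hy, rfl⟩
  obtain ⟨x, hx, e⟩ := h.exists_apply_eq_conj hsub hy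
  refine ⟨x, hx, ?_⟩
  have e' : (π.comp α.toStarAlgHom) x = π (α x) := rfl
  rw [e', e, Unitary.conjStarAlgAut_apply, Unitary.conjStarAlgAut_apply, map_mul, map_mul,
    map_star]
  rfl

end Representation

/-! ### Decay functions -/

theorem IsDecay.nonneg {f : ℝ → ℝ} (hf : IsDecay f) {t : ℝ} (ht : 0 ≤ t) : 0 ≤ f t := by
  refine le_of_tendsto hf.2 ?_
  filter_upwards [eventually_ge_atTop t] with s hs
  exact hf.1 ht (ht.trans hs) hs

theorem IsDecay.add {f g : ℝ → ℝ} (hf : IsDecay f) (hg : IsDecay g) :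
    IsDecay fun t => f t + g t :=
  ⟨fun _ ha _ hb hab => add_le_add (hf.1 ha hb hab) (hg.1 ha hb hab), by
    simpa using hf.2.add hg.2⟩

/-- Reparametrization of a decay function, with a jump to absorb small arguments. -/
theorem IsDecay.delay {f : ℝ → ℝ} (hf : IsDecay f) (R : ℝ) :
    IsDecay fun t => f (max ((t - R) / 2) 0) + if t < R then 2 else 0 := by
  refine ⟨fun a _ b _ hab => add_le_add ?_ ?_, ?_⟩
  · exact hf.1 (mem_Ici.2 (le_max_right _ _)) (mem_Ici.2 (le_max_right _ _)) (max_le_max_right _ (by linarith))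
  · split_ifs <;> linarith
  · have h1 : Tendsto (fun t : ℝ => max ((t - R) / 2) 0) atTop atTop := by
      refine tendsto_atTop_mono (fun t => le_max_left _ _) ?_
      exact (tendsto_atTop_add_const_right atTop (-R) tendsto_id).atTop_div_const two_pos
    have h2 : Tendsto (fun t : ℝ => if t < R then (2 : ℝ) else 0) atTop (𝓝 0) := by
      refine tendsto_const_nhds.congr' ?_
      filter_upwards [eventually_ge_atTop R] with t ht
      rw [if_neg (not_lt.2 ht)]
    simpa using (hf.2.comp h1).add h2

theorem isDecay_zero : IsDecay fun _ => 0 :=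
  ⟨fun _ _ _ _ _ => le_rfl, tendsto_const_nhds⟩

/-! ### Approximate Haag duality of the composite representation -/

section Main

variable {d : ℕ} {H : Type*} [NormedAddCommGroup H] [InnerProductSpace ℂ H] [CompleteSpace H]
  {π : spinAlgebra d →⋆ₐ[ℂ] (H →L[ℂ] H)} {α : spinAlgebra d ≃⋆ₐ[ℂ] spinAlgebra d}

/-- A unitary in `π(𝒜_D)''` is close to one in `π(α(𝒜_Γ))''`, if a factorization of `α⁻¹` along `D`
has a unitary close to one in `𝒜_Γ`. -/
theorem exists_unitary_regionBicommutant_comp {D : Cone} {δ : ℝ} {w w' : unitary (spinAlgebra d)}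
    (hw : FactorizesAlong α.symm D δ w) (hsub : D.toSet ⊆ (D.fatten δ).toSet) {Γ : Set Plane}
    (hΓ : (D.fatten δ).toSet ⊆ Γ) (hw' : (w' : spinAlgebra d) ∈ regionAlgebra d Γ)
    (Y : unitary (H →L[ℂ] H)) (hY : (Y : H →L[ℂ] H) ∈ regionBicommutant π D.toSet) :
    ∃ Z : unitary (H →L[ℂ] H),
      (Z : H →L[ℂ] H) ∈ regionBicommutant (π.comp α.toStarAlgHom) Γ ∧
      ‖(Y : H →L[ℂ] H) - Z‖
        ≤ ‖(w : spinAlgebra d) - w'‖ + ‖(w : spinAlgebra d) - w'‖ := by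
  set W := mapUnitary (π.comp α.toStarAlgHom) w with hW
  set W' := mapUnitary (π.comp α.toStarAlgHom) w' with hW'
  set X : unitary (H →L[ℂ] H) := star W * Y * W with hX
  have hXmem : (X : H →L[ℂ] H) ∈ regionBicommutant (π.comp α.toStarAlgHom) Γ :=
    regionBicommutant_mono _ hΓ (hw.conj_mem_regionBicommutant hsub hY)
  have hYX : Y = W * X * star W := by
    rw [hX, Unitary.star_eq_inv]
    group
  -- `W` itself need not be localized in `Γ`; replacing it by `W'` on both sides of `X` costs `‖w -
  -- w'‖` twice.
  refine ⟨W' * X * star W', ?_, ?_⟩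
  · exact Set.mul_mem_centralizer (Set.mul_mem_centralizer
      (apply_mem_regionBicommutant _ hw') hXmem) (star_apply_mem_regionBicommutant _ hw')
  · have hd : ‖(W : H →L[ℂ] H) - W'‖ ≤ ‖(w : spinAlgebra d) - w'‖ := norm_mapUnitary_sub_le _ _ _
    rw [hYX]
    refine (norm_unitary_mul_sub_le _ _ _ _).trans ?_
    rw [norm_unitary_star_sub]
    refine add_le_add ((norm_unitary_mul_sub_le _ _ _ _).trans ?_) hd
    simpa using hd

theorem ApproxHaagDuality.comp (hπ : ApproxHaagDuality π) (hα : ApproxFactorizable α) :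
    ApproxHaagDuality (π.comp α.toStarAlgHom) := by
  intro φ ε hφ hφ2 hε hφε
  -- The half-angle grows by at most `4κ` beyond `η` in the tail estimate and by `3κ` in the
  -- inclusion, so `4κ ≤ ε` covers both; `8κ ≤ φ` keeps the narrowed cones nondegenerate.
  obtain ⟨κ, hκ, hκε, hκφ⟩ : ∃ κ, 0 < κ ∧ 4 * κ ≤ ε ∧ 8 * κ ≤ φ :=
    ⟨min (ε / 4) (φ / 8), by positivity, by linarith [min_le_left (ε / 4) (φ / 8)],
      by linarith [min_le_right (ε / 4) (φ / 8)]⟩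
  obtain ⟨g₁, hg₁, H₁⟩ := hα φ κ hφ hφ2 hκ
  obtain ⟨R, f₀, hR, hf₀, H₀⟩ := hπ (φ + 2 * κ) κ (by linarith) (by linarith) hκ (by linarith)
  obtain ⟨g₂, hg₂, H₂⟩ := hα (φ + 4 * κ) κ (by linarith) (by linarith) hκ
  -- The opening angle of `D` depends on `η`, so a separate decay function is chosen for each `η`
  -- before `Λ` is given; it is zero for inadmissible `η`.
  have H₃ : ∀ η : ℝ, ∃ h : ℝ → ℝ, IsDecay h ∧ (0 < η → φ + 4 * κ + 2 * η < 2 * Real.pi →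
      ∀ D : Cone, D.angle = φ + 4 * κ + 2 * η → D.IsCone → (D.fatten κ).IsCone →
        (D.fatten (-κ)).IsCone → (D.fatten (κ + κ)).IsCone →
        ∃ w : unitary (spinAlgebra d), FactorizesAlong α.symm D κ w ∧ ∀ t, 0 ≤ t →
          ∃ w' : unitary (spinAlgebra d),
            (w' : spinAlgebra d) ∈ regionAlgebra d ((D.fatten (κ + κ)).pullBack t).toSet ∧
            ‖(w : spinAlgebra d) - w'‖ ≤ h t) := by
    intro η
    by_cases hη : 0 < η ∧ φ + 4 * κ + 2 * η < 2 * Real.pi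
    · obtain ⟨g, hg, Hg⟩ := hα (φ + 4 * κ + 2 * η) κ (by linarith) hη.2 hκ
      refine ⟨g κ, hg κ hκ, fun _ _ D hD h1 h2 h3 h4 => ?_⟩
      obtain ⟨_, w, -, hw, happ⟩ := Hg D h1 hD h2 h3
      refine ⟨w, hw, fun t ht => ?_⟩
      obtain ⟨_, w', -, hw', -, hn⟩ := happ κ t hκ h4 ht
      exact ⟨w', hw', hn⟩
    · exact ⟨fun _ => 0, isDecay_zero, fun h1 h2 => absurd ⟨h1, h2⟩ hη⟩
  choose g₃ hg₃ H₃ using H₃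
  -- The summands are the errors for `v`, `U₀`, the two sides of the conjugation along `D`, and `w`.
  -- The jump `2` covers `T < R`, where the identity serves as approximant.
  refine ⟨R, fun η T => (fun t => g₁ η t + f₀ η t + (g₃ η t + g₃ η t) + g₂ η t)
    (max ((T - R) / 2) 0) + if T < R then 2 else 0, hR, fun η hη => ?_, ?_⟩
  · exact ((((hg₁ η hη).add (hf₀ η hη)).add ((hg₃ η).add (hg₃ η))).add (hg₂ η hη)).delay R
  intro Λ hΛ hΛφ
  have hang : 2 * Λ.halfAngle = φ := hΛφ
  have cone_fatten : ∀ a, -(2 * κ) ≤ a → a ≤ ε → (Λ.fatten a).IsCone := fun a h1 h2 =>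
    ⟨by change 0 < Λ.halfAngle + a; linarith, by change Λ.halfAngle + a < Real.pi; linarith⟩
  have hΛsub : Λ.toSet ⊆ (Λ.fatten κ).toSet := by
    conv_lhs => rw [← Λ.fatten_zero]
    exact Λ.toSet_fatten_mono (by linarith) hκ.le (by linarith)
  obtain ⟨v, _, hv, -, hvapp⟩ := H₁ Λ hΛ hΛφ (cone_fatten _ (by linarith) (by linarith))
    (cone_fatten _ (by linarith) (by linarith))
  obtain ⟨U₀, hU₀, hU₀app⟩ := H₀ (Λ.fatten κ) (cone_fatten _ (by linarith) (by linarith))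
    (by change 2 * (Λ.halfAngle + κ) = _; linarith)
  -- the cone that carries the commutant of `π` after the two previous steps
  obtain ⟨Γ, hΓ⟩ : ∃ Γ, Γ = (Λ.fatten (2 * κ)).pullBack R := ⟨_, rfl⟩
  have hΓ' : ((Λ.fatten κ).pullBack R).fatten κ = Γ := by
    rw [hΓ, ← Cone.fatten_pullBack, Cone.fatten_fatten, two_mul]
  have hΓf : ∀ a, Γ.fatten a = (Λ.fatten (2 * κ + a)).pullBack R := fun a => by
    rw [hΓ, ← Cone.fatten_pullBack, Cone.fatten_fatten]
  obtain ⟨_, w, -, hw, hwapp⟩ := H₂ Γ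
    (by rw [hΓ]; exact cone_fatten (2 * κ) (by linarith) (by linarith))
    (by rw [hΓ]; change 2 * (Λ.halfAngle + 2 * κ) = _; linarith)
    (by rw [hΓf]; exact cone_fatten (2 * κ + κ) (by linarith) (by linarith))
    (by rw [hΓf]; exact cone_fatten (2 * κ + -κ) (by linarith) (by linarith))
  have hΓsub : Γ.toSet ⊆ (Γ.fatten κ).toSet := by
    rw [hΓf, hΓ]
    exact Λ.toSet_fatten_pullBack_mono (by linarith) (by linarith) (by linarith) le_rfl
  refine ⟨mapUnitary π v * U₀ * mapUnitary (π.comp α.toStarAlgHom) w, ?_, ?_⟩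
  · intro X hX
    obtain ⟨Y, hY, hYX⟩ := hU₀ (hv.conj_mem_regionCommutant hΛsub hX)
    rw [hΓ'] at hY
    refine ⟨_, regionBicommutant_mono _ ?_ (hw.conj_mem_regionBicommutant hΓsub hY), ?_⟩
    -- `Γ_κ` is `Λ_{3κ} - R e_Λ`, and `3κ ≤ ε`.
    · rw [hΓf, ← Cone.fatten_pullBack]
      exact Λ.toSet_fatten_pullBack_mono (by linarith) (by linarith) (by linarith) le_rfl
    · rw [Unitary.conjStarAlgAut_mul_apply, Unitary.conjStarAlgAut_mul_apply,
        StarAlgEquiv.apply_symm_apply, hYX, StarAlgEquiv.apply_symm_apply]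
  intro η T hη hcone hT
  have hpi : Λ.halfAngle + (ε + η) < Real.pi := hcone.2
  have cone_fatten' : ∀ a, -(2 * κ) ≤ a → a ≤ ε + η → (Λ.fatten a).IsCone := fun a h1 h2 =>
    ⟨by change 0 < Λ.halfAngle + a; linarith, by change Λ.halfAngle + a < Real.pi; linarith⟩
  -- The approximant of `π(v) U₀` is pulled back by `t` twice, that of `πα(w)` by `R + t`; for `T ≥
  -- R` both are at most `R + 2t = T`.
  obtain ⟨t, ht⟩ : ∃ t, t = max ((T - R) / 2) 0 := ⟨_, rfl⟩
  have ht0 : 0 ≤ t := ht ▸ le_max_right _ _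
  have hF : 0 ≤ g₁ η t + f₀ η t + (g₃ η t + g₃ η t) + g₂ η t := by
    have := (hg₁ η hη).nonneg ht0
    have := (hf₀ η hη).nonneg ht0
    have := (hg₃ η).nonneg ht0
    have := (hg₂ η hη).nonneg ht0
    positivity
  simp only [← ht]
  by_cases hTR : T < R
  · refine ⟨1, Set.one_mem_centralizer, (norm_unitary_sub_one_le _).trans ?_⟩
    rw [if_pos hTR]
    linarith
  rw [if_neg hTR, add_zero]
  have hTt : R + t + t = T := by
    rw [ht, max_eq_left (by linarith)]
    ring
  obtain ⟨v', _, hv', -, hvn, -⟩ := hvapp η t hη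
    (cone_fatten' _ (by linarith) (by linarith)) ht0
  obtain ⟨V₀, hV₀, hV₀n⟩ := hU₀app η t hη
    (by rw [Cone.fatten_fatten]; exact cone_fatten' _ (by linarith) (by linarith)) ht0
  obtain ⟨_, w', -, hw', -, hwn⟩ := hwapp η t hη
    (by rw [hΓf]; exact cone_fatten' (2 * κ + (κ + η)) (by linarith) (by linarith)) ht0
  -- This cone contains the supports of both approximants: `v'` needs angle `κ + η`, and `V₀` needs
  -- `κ + (κ + η)`.
  obtain ⟨D, hD⟩ : ∃ D, D = (Λ.fatten (2 * κ + η)).pullBack t := ⟨_, rfl⟩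
  have hDf : ∀ a, D.fatten a = (Λ.fatten (2 * κ + η + a)).pullBack t := fun a => by
    rw [hD, ← Cone.fatten_pullBack, Cone.fatten_fatten]
  obtain ⟨w₂, hw₂, hw₂app⟩ := H₃ η hη (by linarith) D
    (by rw [hD]; change 2 * (Λ.halfAngle + (2 * κ + η)) = _; linarith)
    (by rw [hD]; exact cone_fatten' (2 * κ + η) (by linarith) (by linarith))
    (by rw [hDf]; exact cone_fatten' (2 * κ + η + κ) (by linarith) (by linarith))
    (by rw [hDf]; exact cone_fatten' (2 * κ + η + -κ) (by linarith) (by linarith))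
    (by rw [hDf]; exact cone_fatten' (2 * κ + η + (κ + κ)) (by linarith) (by linarith))
  obtain ⟨w₂', hw₂', hw₂n⟩ := hw₂app t ht0
  have hY : ((mapUnitary π v' * V₀ : unitary (H →L[ℂ] H)) : H →L[ℂ] H) ∈
      regionBicommutant π D.toSet := by
    refine Set.mul_mem_centralizer ?_ ?_
    · refine apply_mem_regionBicommutant π (regionAlgebra_mono ?_ hv')
      rw [hD]
      exact Λ.toSet_fatten_pullBack_mono (by linarith) (by linarith) (by linarith) le_rfl
    · refine regionBicommutant_mono π ?_ hV₀
      rw [hD, Cone.fatten_fatten]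
      exact Λ.toSet_fatten_pullBack_mono (by linarith) (by linarith) (by linarith) le_rfl
  have hw₂'' : (w₂' : spinAlgebra d) ∈
      regionAlgebra d ((Λ.fatten (ε + η)).pullBack T).toSet := by
    refine regionAlgebra_mono ?_ hw₂'
    rw [hDf, Cone.pullBack_pullBack]
    exact Λ.toSet_fatten_pullBack_mono (by linarith) (by linarith) (by linarith) (by linarith)
  obtain ⟨Z, hZ, hYZ⟩ := exists_unitary_regionBicommutant_comp hw₂
    (by rw [hDf, hD]
        exact Λ.toSet_fatten_pullBack_mono (by linarith) (by linarith) (by linarith) le_rfl)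
    (by rw [hDf]
        exact Λ.toSet_fatten_pullBack_mono (by linarith) (by linarith) (by linarith)
          (by linarith)) hw₂'' _ hY
  refine ⟨Z * mapUnitary (π.comp α.toStarAlgHom) w', ?_, ?_⟩
  · refine Set.mul_mem_centralizer hZ
      (apply_mem_regionBicommutant _ (regionAlgebra_mono ?_ hw'))
    rw [hΓf, Cone.pullBack_pullBack]
    exact Λ.toSet_fatten_pullBack_mono (by linarith) (by linarith) (by linarith) (by linarith)
  · refine (norm_unitary_mul_sub_le _ _ _ _).trans
      (add_le_add ?_ ((norm_mapUnitary_sub_le _ _ _).trans hwn))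
    refine (norm_sub_le_norm_sub_add_norm_sub _
      ((mapUnitary π v' * V₀ : unitary (H →L[ℂ] H)) : H →L[ℂ] H) _).trans
      (add_le_add ?_ (hYZ.trans (add_le_add hw₂n hw₂n)))
    exact (norm_unitary_mul_sub_le _ _ _ _).trans
      (add_le_add ((norm_mapUnitary_sub_le _ _ _).trans hvn) hV₀n)

end Main

end SpinSystem

theorem proposition1p3 (d : ℕ) (hd : 2 ≤ d)
    (H : Type*) [NormedAddCommGroup H] [InnerProductSpace ℂ H] [CompleteSpace H]
    (π₀ : SpinSystem.spinAlgebra d →⋆ₐ[ℂ] (H →L[ℂ] H))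
    (hirr : SpinSystem.IsIrreducibleRep π₀)
    (hπ₀ : SpinSystem.ApproxHaagDuality π₀)
    (α : SpinSystem.spinAlgebra d ≃⋆ₐ[ℂ] SpinSystem.spinAlgebra d)
    (hα : SpinSystem.ApproxFactorizable α) :
    SpinSystem.IsIrreducibleRep (π₀.comp α.toStarAlgHom) ∧
      SpinSystem.ApproxHaagDuality (π₀.comp α.toStarAlgHom) := by
  exact ⟨hirr.comp α, hπ₀.comp hα⟩
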